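/- \textbf{Proposition (ADMM client update).} Let $\|\cdot\|$ be any norm on $\mathbb{R}^P$ with dual norm $\|\cdot\|_*$ (with respect to the standard inner product), let $\kappa\ge 0$, $\rho>0$, and equip $\Xi=\mathbb{R}^P\times\{-1,+1\}$ with the transportation cost $d((x,y),(x',y'))=\|x-x'\|+\kappa\,\mathbb{1}_{\{y\ne y'\}}$. For probability measures $\mathbb{Q},\mathbb{Q}'$ on $\Xi$ let $W_{d,1}(\mathbb{Q},\mathbb{Q}')=\inf_\pi\int d\,\mathrm{d}\pi$, the infimum being over all couplings $\pi$ of $\mathbb{Q}$ and $\mathbb{Q}'$. Let $\ell_H(w;(x,y))=\max\{0,1-y\,w^{\mathsf T}x\}$. For $g=1,\dots,G$ let client $g$ have weight $\alpha_g\ge 0$ ($\sum_g\alpha_g=1$), radius $\varepsilon_g\ge 0$, and training samples $(\widehat x_n,\widehat y_n)\in\Xi$, $n=1,\dots,N_g$, $N_g\ge 1$ (samples depend on $g$), with empirical distribution $\widehat{\mathbb{P}}_{N_g}$, and let $\mathcal{A}^{(g)}$ be the set of all probability measures $\mathbb{Q}$ on $\Xi$ with $W_{d,1}(\mathbb{Q},\widehat{\mathbb{P}}_{N_g})\le\varepsilon_g$.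 Define \[ \mathcal{L}_{\rho_g}(w_g,w,\mu_g)=\sup_{\mathbb{Q}\in\mathcal{A}^{(g)}}\mathbb{E}^{\mathbb{Q}}[\ell_H(w_g;\xi)]+\frac{\rho}{2}\|w_g-w+\mu_g\|_2^2,\qquad \mathcal{L}_\rho=\sum_{g=1}^G\alpha_g\,\mathcal{L}_{\rho_g}(w_g,w,\mu_g). \] Fix $w,\mu_1,\dots,\mu_G\in\mathbb{R}^P$ and a client $g$, and consider the program $J_g(w,\mu_g)$ in the variables $w_g\in\mathbb{R}^P$, $\lambda\in\mathbb{R}$, $s\in\mathbb{R}^{N_g}$: \[ \begin{aligned} \min_{w_g,\lambda,s}\quad&\lambda\varepsilon_g+\frac1{N_g}\sum_{n=1}^{N_g}s_n+\frac{\rho}{2}\|w_g-w+\mu_g\|_2^2\\ \text{s.t.}\quad&\ell_H(w_g;(\widehat x_n,\widehat y_n))\le s_n,\qquad \ell_H(w_g;(\widehat x_n,-\widehat y_n))-\kappa\lambda\le s_n\qquad(n=1,\dots,N_g),\\ &\lambda\ge\|w_g\|_*. \end{aligned} \] Then: (i) this is a convex program (its objective and constraint functions are convex, hence so is its feasible set);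 (ii) its minimum is attained, $\min_{w_g}\mathcal{L}_{\rho_g}(w_g,w,\mu_g)$ is attained, and the two values are equal and finite; (iii) exactly one $w_g$ occurs in optimal solutions $(w_g,\lambda,s)$ of the program; (iv) a vector $w_g$ minimizes $\mathcal{L}_{\rho_g}(\cdot,w,\mu_g)$ if and only if $(w_g,\lambda,s)$ is an optimal solution of the program for some $\lambda,s$; (v) for arbitrary values of the other clients' models, any such $w_g$ minimizes the global augmented Lagrangian $\mathcal{L}_\rho$ with respect to its $g$-th model, and, if $\alpha_g>0$, every minimizer of $\mathcal{L}_\rho$ with respect to its $g$-th model is such a $w_g$. -/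

import Mathlib

open MeasureTheory
open scoped ENNReal NNReal

namespace FDRSVM

/-- Feature and parameter space `ℝ^P`; its own norm is the `ℓ²`-norm. -/
abbrev Feature (P : ℕ) : Type := EuclideanSpace ℝ (Fin P)

/-- Labelled data `ξ = (x, y)` with `x ∈ ℝ^P` and `y ∈ {-1, +1}`
(the units of `ℤ` are exactly `1` and `-1`). -/
abbrev Sample (P : ℕ) : Type := Feature P × ℤˣ

/-- The sample with flipped label, `(x, y) ↦ (x, -y)`. -/
def flipLabel {P : ℕ} (ξ : Sample P) : Sample P := (ξ.1, -ξ.2)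

/-- Hinge loss `max {0, 1 - y wᵀx}`. -/
noncomputable def hinge {P : ℕ} (w : Feature P) (ξ : Sample P) : ℝ :=
  max 0 (1 - ((ξ.2 : ℤ) : ℝ) * inner ℝ w ξ.1)

/-- Transportation cost `‖x - x'‖ + κ 1{y ≠ y'}` for a norm `nrm` on `ℝ^P`. -/
noncomputable def cost {P : ℕ} (nrm : Seminorm ℝ (Feature P)) (κ : ℝ) (ξ ξ' : Sample P) : ℝ :=
  nrm (ξ.1 - ξ'.1) + if ξ.2 ≠ ξ'.2 then κ else 0

/-- Dual norm `‖w‖_* = sup {wᵀx : ‖x‖ ≤ 1}` of a norm `nrm` on `ℝ^P`. -/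
noncomputable def dualNorm {P : ℕ} (nrm : Seminorm ℝ (Feature P)) (w : Feature P) : ℝ :=
  sSup ((fun x : Feature P => (inner ℝ w x : ℝ)) '' {x | nrm x ≤ 1})

/-- Type-1 Wasserstein distance with transportation cost `cost nrm κ`: the infimum of the expected
cost over all couplings. -/
noncomputable def wasserstein {P : ℕ} (nrm : Seminorm ℝ (Feature P)) (κ : ℝ)
    (Q Q' : Measure (Sample P)) : ℝ≥0∞ :=
  ⨅ π ∈ {π : Measure (Sample P × Sample P) | π.map Prod.fst = Q ∧ π.map Prod.snd = Q'},
    ∫⁻ p, ENNReal.ofReal (cost nrm κ p.1 p.2) ∂π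

/-- Empirical distribution of a finite training set. -/
noncomputable def empirical {P N : ℕ} (S : Fin N → Sample P) : Measure (Sample P) :=
  (N : ℝ≥0∞)⁻¹ • ∑ n, Measure.dirac (S n)

/-- Wasserstein ball of radius `ε` around the empirical distribution of the training set `S`. -/
def ambiguitySet {P N : ℕ} (nrm : Seminorm ℝ (Feature P)) (κ ε : ℝ) (S : Fin N → Sample P) :
    Set (Measure (Sample P)) :=
  {Q | IsProbabilityMeasure Q ∧ wasserstein nrm κ Q (empirical S) ≤ ENNReal.ofReal ε}

/-- Local worst-case risk: the supremum over the Wasserstein ball of the expected hinge loss.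
The loss is nonnegative, so the expectation is the `[0, ∞]`-valued integral. -/
noncomputable def worstCaseRisk {P N : ℕ} (nrm : Seminorm ℝ (Feature P)) (κ ε : ℝ)
    (S : Fin N → Sample P) (w : Feature P) : ℝ≥0∞ :=
  ⨆ Q ∈ ambiguitySet nrm κ ε S, ∫⁻ ξ, ENNReal.ofReal (hinge w ξ) ∂Q

/-- Local augmented Lagrangian: local worst-case risk plus `(ρ/2) ‖w_g - w + μ_g‖₂²`. -/
noncomputable def localLagrangian {P N : ℕ} (nrm : Seminorm ℝ (Feature P)) (κ ε ρ : ℝ)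
    (S : Fin N → Sample P) (w μg wg : Feature P) : ℝ≥0∞ :=
  worstCaseRisk nrm κ ε S wg + ENNReal.ofReal (ρ / 2 * ‖wg - w + μg‖ ^ 2)

/-- Global augmented Lagrangian: the weighted sum of the local ones. -/
noncomputable def augLagrangian {P G : ℕ} {N : Fin G → ℕ} (nrm : Seminorm ℝ (Feature P)) (κ : ℝ)
    (ε α : Fin G → ℝ) (ρ : ℝ) (S : (g : Fin G) → Fin (N g) → Sample P)
    (wloc : Fin G → Feature P) (w : Feature P) (μ : Fin G → Feature P) : ℝ≥0∞ :=
  ∑ g, ENNReal.ofReal (α g) * localLagrangian nrm κ (ε g) ρ (S g) w (μ g) (wloc g)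

/-- Decision variables of the client program. -/
abbrev ClientVar (P N : ℕ) : Type := Feature P × ℝ × (Fin N → ℝ)

/-- Objective of the client program at `(w_g, λ, s)`:
`λ ε + (1/N) ∑ s_n + (ρ/2) ‖w_g - w + μ_g‖₂²`. -/
noncomputable def clientObjective {P N : ℕ} (ε ρ : ℝ) (w μg : Feature P) (z : ClientVar P N) : ℝ :=
  z.2.1 * ε + (1 / (N : ℝ)) * ∑ n, z.2.2 n + ρ / 2 * ‖z.1 - w + μg‖ ^ 2

/-- Feasible set of the client program: points `(w_g, λ, s)` satisfying the hinge constraints for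
the true label and for the flipped label, and `λ ≥ ‖w_g‖_*`. -/
def clientFeasible {P N : ℕ} (nrm : Seminorm ℝ (Feature P)) (κ : ℝ) (S : Fin N → Sample P) :
    Set (ClientVar P N) :=
  {z | (∀ n, hinge z.1 (S n) ≤ z.2.2 n) ∧
       (∀ n, hinge z.1 (flipLabel (S n)) - κ * z.2.1 ≤ z.2.2 n) ∧
       dualNorm nrm z.1 ≤ z.2.1}

/-- `z` is an optimal solution of the client program. -/
def IsClientOptimal {P N : ℕ} (nrm : Seminorm ℝ (Feature P)) (κ ε ρ : ℝ) (S : Fin N → Sample P)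
    (w μg : Feature P) (z : ClientVar P N) : Prop :=
  z ∈ clientFeasible nrm κ S ∧ IsMinOn (clientObjective ε ρ w μg) (clientFeasible nrm κ S) z

end FDRSVM

/-!
The heart of the matter is strong duality for the worst-case hinge risk `R(w)` over a Wasserstein
ball: `R(w)` is the minimum over `(l, s)` of the client objective without its quadratic term,
subject to the constraints of the client program.

* *Upper bound* (`worstCaseRisk_le`). The hinge loss is Lipschitz in the features with constant
  `‖w‖_*`, so for `l ≥ ‖w‖_*` transporting a training sample raises its loss by at most `l` times
  the cost, beyond what a label flip at price `κ l` brings (`hinge_le_mul_cost_add`). Integrating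
  against a coupling bounds the expected loss.
* *Lower bound* (`exists_feasible_le_worstCaseRisk`). An adversary flips labels with probabilities
  `q` and spends the remaining budget on the features, moving a vanishing fraction of the mass very
  far in a direction that nearly attains `‖w‖_*` (`flip_add_shift_le_worstCaseRisk`). The best `q`
  solves a fractional knapsack problem, and its multiplier `l` together with complementary slackness
  (`exists_knapsack_multiplier`) shows that the adversary reaches the dual value at `l`. In
  particular the dual minimum is attained, also for `ε = 0` and for `κ = 0`.

Hence `R` is a finite partial minimum of a jointly convex program, thus convex, and adding the
quadratic term makes the local Lagrangian strictly convex, continuous and coercive: it has exactly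
one minimizer. Optimal points of the client program project onto minimizers of the local Lagrangian
and every minimizer lifts (`exists_isClientOptimal_iff`). The global Lagrangian depends on block `g`
through `α g` times the local one plus a finite constant (`augLagrangian_update`), which gives the
last claim.
-/

namespace FDRSVM

/-! ### The norm and its dual norm -/

theorem continuous_nrm {P : ℕ} (nrm : Seminorm ℝ (Feature P)) : Continuous nrm :=
  continuousOn_univ.1 (nrm.convexOn.continuousOn isOpen_univ)

/-- A norm on `ℝ^P` dominates a multiple of the Euclidean norm. -/
theorem exists_norm_le_mul_nrm {P : ℕ} (nrm : Seminorm ℝ (Feature P))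
    (hnrm : ∀ x, nrm x = 0 → x = 0) : ∃ C : ℝ, ∀ x, ‖x‖ ≤ C * nrm x := by
  by_cases hne : (Metric.sphere (0 : Feature P) 1).Nonempty
  · obtain ⟨x₀, hx₀, hmin⟩ := (isCompact_sphere (0 : Feature P) 1).exists_isMinOn hne
      (continuous_nrm nrm).continuousOn
    have hpos : 0 < nrm x₀ := by
      refine lt_of_le_of_ne (apply_nonneg nrm x₀) fun h => ?_
      rw [hnrm x₀ h.symm] at hx₀
      simp at hx₀
    refine ⟨(nrm x₀)⁻¹, fun x => ?_⟩
    rcases eq_or_ne x 0 with rfl | hx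
    · simp
    have hx' : 0 < ‖x‖ := norm_pos_iff.2 hx
    have h : nrm x₀ ≤ nrm (‖x‖⁻¹ • x) := hmin (by simp [norm_smul, hx'.ne'])
    rw [map_smul_eq_mul, norm_inv, norm_norm] at h
    rw [inv_mul_eq_div, le_div_iff₀ hpos]
    rwa [inv_mul_eq_div, le_div_iff₀ hx', mul_comm] at h
  · refine ⟨0, fun x => ?_⟩
    rcases eq_or_ne x 0 with rfl | hx
    · simp
    · exact absurd ⟨‖x‖⁻¹ • x, by simp [norm_smul, norm_ne_zero_iff.2 hx]⟩ hne

theorem bddAbove_dualNorm {P : ℕ} (nrm : Seminorm ℝ (Feature P))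
    (hnrm : ∀ x, nrm x = 0 → x = 0) (w : Feature P) :
    BddAbove ((fun x : Feature P => (inner ℝ w x : ℝ)) '' {x | nrm x ≤ 1}) := by
  obtain ⟨C, hC⟩ := exists_norm_le_mul_nrm nrm hnrm
  refine ⟨‖w‖ * |C|, ?_⟩
  rintro _ ⟨x, hx, rfl⟩
  have h2 : ‖x‖ ≤ |C| := (hC x).trans <| (mul_le_mul_of_nonneg_right (le_abs_self C)
    (apply_nonneg nrm x)).trans (mul_le_of_le_one_right (abs_nonneg C) hx)
  exact (real_inner_le_norm w x).trans (mul_le_mul_of_nonneg_left h2 (norm_nonneg w))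

theorem dualNorm_nonneg {P : ℕ} (nrm : Seminorm ℝ (Feature P))
    (hnrm : ∀ x, nrm x = 0 → x = 0) (w : Feature P) : 0 ≤ dualNorm nrm w :=
  le_csSup (bddAbove_dualNorm nrm hnrm w) ⟨0, by simp, by simp⟩

theorem inner_le_dualNorm_mul {P : ℕ} (nrm : Seminorm ℝ (Feature P))
    (hnrm : ∀ x, nrm x = 0 → x = 0) (w x : Feature P) :
    inner ℝ w x ≤ dualNorm nrm w * nrm x := by
  rcases eq_or_ne x 0 with rfl | hx
  · simp
  have hpos : 0 < nrm x := lt_of_le_of_ne (apply_nonneg nrm x) fun h => hx (hnrm x h.symm)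
  have h : inner ℝ w ((nrm x)⁻¹ • x) ≤ dualNorm nrm w :=
    le_csSup (bddAbove_dualNorm nrm hnrm w) ⟨_, by
      simp [map_smul_eq_mul, abs_of_pos hpos, hpos.ne'], rfl⟩
  rwa [real_inner_smul_right, inv_mul_eq_div, div_le_iff₀ hpos] at h

theorem dualNorm_le {P : ℕ} (nrm : Seminorm ℝ (Feature P)) {w : Feature P} {c : ℝ}
    (h : ∀ x, nrm x ≤ 1 → inner ℝ w x ≤ c) : dualNorm nrm w ≤ c :=
  csSup_le ⟨_, 0, by simp, rfl⟩ (by rintro _ ⟨x, hx, rfl⟩; exact h x hx)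

theorem convexOn_dualNorm {P : ℕ} (nrm : Seminorm ℝ (Feature P))
    (hnrm : ∀ x, nrm x = 0 → x = 0) : ConvexOn ℝ Set.univ (dualNorm nrm) := by
  refine ⟨convex_univ, fun v _ w _ a b ha hb _ => dualNorm_le nrm fun x hx => ?_⟩
  have hle (w : Feature P) : inner ℝ w x ≤ dualNorm nrm w :=
    le_csSup (bddAbove_dualNorm nrm hnrm w) ⟨x, hx, rfl⟩
  rw [inner_add_left, real_inner_smul_left, real_inner_smul_left, smul_eq_mul, smul_eq_mul]
  exact add_le_add (mul_le_mul_of_nonneg_left (hle v) ha) (mul_le_mul_of_nonneg_left (hle w) hb)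

/-! ### The hinge loss -/

theorem hinge_nonneg {P : ℕ} (w : Feature P) (ξ : Sample P) : 0 ≤ hinge w ξ := le_max_left _ _

theorem le_hinge {P : ℕ} (w : Feature P) (ξ : Sample P) :
    1 - ((ξ.2 : ℤ) : ℝ) * inner ℝ w ξ.1 ≤ hinge w ξ := le_max_right _ _

theorem convexOn_hinge {P : ℕ} (ξ : Sample P) :
    ConvexOn ℝ Set.univ (fun w : Feature P => hinge w ξ) := by
  refine (convexOn_const 0 convex_univ).sup ⟨convex_univ, fun v _ w _ a b _ _ hab => le_of_eq ?_⟩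
  simp only [inner_add_left, real_inner_smul_left, smul_eq_mul]
  linear_combination -hab

theorem mul_inner_le_dualNorm_mul {P : ℕ} (nrm : Seminorm ℝ (Feature P))
    (hnrm : ∀ x, nrm x = 0 → x = 0) (y : ℤˣ) (w x : Feature P) :
    ((y : ℤ) : ℝ) * inner ℝ w x ≤ dualNorm nrm w * nrm x := by
  rcases Int.units_eq_one_or y with rfl | rfl
  · simpa using inner_le_dualNorm_mul nrm hnrm w x
  · simpa [inner_neg_right] using inner_le_dualNorm_mul nrm hnrm w (-x)

/-- The hinge loss is Lipschitz in the feature vector, with constant the dual norm of the model. -/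
theorem hinge_le_hinge_add {P : ℕ} (nrm : Seminorm ℝ (Feature P))
    (hnrm : ∀ x, nrm x = 0 → x = 0) (w x x' : Feature P) (y : ℤˣ) :
    hinge w (x, y) ≤ hinge w (x', y) + dualNorm nrm w * nrm (x - x') := by
  have h := mul_inner_le_dualNorm_mul nrm hnrm y w (x' - x)
  rw [map_sub_rev, inner_sub_right] at h
  have h0 : 0 ≤ dualNorm nrm w * nrm (x - x') :=
    mul_nonneg (dualNorm_nonneg nrm hnrm w) (apply_nonneg nrm _)
  have h1 := hinge_nonneg w (x', y)
  have h2 := le_hinge w (x', y)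
  refine max_le (by linarith) ?_
  simp only at h2 ⊢
  linarith

/-- Transport inequality behind weak duality: moving `ξ'` to `ξ` at price `l ≥ ‖w‖_*` per unit of
cost, the loss at `ξ` is at most the price paid plus the better of keeping the label of `ξ'` and
flipping it for `κ l`. -/
theorem hinge_le_mul_cost_add {P : ℕ} (nrm : Seminorm ℝ (Feature P))
    (hnrm : ∀ x, nrm x = 0 → x = 0) (κ : ℝ) {w : Feature P} {l : ℝ}
    (hl : dualNorm nrm w ≤ l) (ξ ξ' : Sample P) :
    hinge w ξ ≤ l * cost nrm κ ξ ξ' + max (hinge w ξ') (hinge w (flipLabel ξ') - κ * l) := by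
  obtain ⟨x, y⟩ := ξ
  obtain ⟨x', y'⟩ := ξ'
  have h := hinge_le_hinge_add nrm hnrm w x x' y
  have hl' := mul_le_mul_of_nonneg_right hl (apply_nonneg nrm (x - x'))
  by_cases hy : y = y'
  · subst hy
    have := le_max_left (hinge w (x', y)) (hinge w (flipLabel (x', y)) - κ * l)
    simp only [cost, ne_eq, not_true_eq_false, if_false]
    linarith
  · have hy' : y = -y' := by
      rcases Int.units_eq_one_or y with rfl | rfl <;>
        rcases Int.units_eq_one_or y' with rfl | rfl <;> simp_all
    have := le_max_right (hinge w (x', y')) (hinge w (flipLabel (x', y')) - κ * l)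
    simp only [cost, ne_eq, hy, not_false_eq_true, if_true]
    simp only [flipLabel, ← hy'] at this ⊢
    linarith

/-! ### Measurability and discrete measures -/

instance measurableSingletonClass_intUnits : MeasurableSingletonClass ℤˣ where
  measurableSet_singleton y := by
    refine ⟨{(y : ℤ)}, measurableSet_singleton _, ?_⟩
    ext z
    simp [Units.ext_iff]

theorem measurable_hinge {P : ℕ} (w : Feature P) : Measurable (hinge w) := by
  refine measurable_from_prod_countable_left fun y => ?_
  have : Continuous fun x : Feature P => hinge w (x, y) := by
    unfold hinge
    fun_prop
  exact this.measurable

theorem lintegral_empirical {P N : ℕ} (S : Fin N → Sample P) (f : Sample P → ℝ≥0∞) :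
    ∫⁻ ξ, f ξ ∂(empirical S) = (N : ℝ≥0∞)⁻¹ * ∑ n, f (S n) := by
  simp [empirical, lintegral_smul_measure]

theorem inv_natCast_mul_sum_ofReal {N : ℕ} (hN : 0 < N) (f : Fin N → ℝ) (hf : ∀ n, 0 ≤ f n) :
    (N : ℝ≥0∞)⁻¹ * ∑ n, ENNReal.ofReal (f n) = ENNReal.ofReal (1 / (N : ℝ) * ∑ n, f n) := by
  have hN' : (0 : ℝ) < N := by exact_mod_cast hN
  rw [ENNReal.ofReal_mul (by positivity), ENNReal.ofReal_sum_of_nonneg fun n _ => hf n, one_div,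
    ENNReal.ofReal_inv_of_pos hN', ENNReal.ofReal_natCast]

/-! ### Weak duality -/

/-- Weak duality: a feasible point of the client program bounds the worst-case risk of its model.
Every coupling is charged through the transport inequality. -/
theorem worstCaseRisk_le {P N : ℕ} (nrm : Seminorm ℝ (Feature P))
    (hnrm : ∀ x, nrm x = 0 → x = 0) {κ ε : ℝ} (hε : 0 ≤ ε) (hN : 0 < N) (S : Fin N → Sample P)
    {z : ClientVar P N} (hz : z ∈ clientFeasible nrm κ S) :
    worstCaseRisk nrm κ ε S z.1 ≤
      ENNReal.ofReal (z.2.1 * ε + 1 / (N : ℝ) * ∑ n, z.2.2 n) := by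
  obtain ⟨w, l, s⟩ := z
  obtain ⟨h1, h2, h3⟩ := hz
  simp only at h1 h2 h3 ⊢
  have hl : 0 ≤ l := (dualNorm_nonneg nrm hnrm w).trans h3
  have hs : ∀ n, 0 ≤ s n := fun n => (hinge_nonneg w _).trans (h1 n)
  set ψ : Sample P → ℝ≥0∞ := fun ξ =>
    max (ENNReal.ofReal (hinge w ξ)) (ENNReal.ofReal (hinge w (flipLabel ξ) - κ * l)) with hψ
  have hψm : Measurable ψ := by
    have hflip : Measurable (flipLabel : Sample P → Sample P) :=
      measurable_fst.prodMk ((measurable_of_countable fun y : ℤˣ => -y).comp measurable_snd)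
    exact (measurable_hinge w).ennreal_ofReal.max
      (((measurable_hinge w).comp hflip).sub_const _).ennreal_ofReal
  have hpt (ξ ξ' : Sample P) : ENNReal.ofReal (hinge w ξ) ≤
      ENNReal.ofReal l * ENNReal.ofReal (cost nrm κ ξ ξ') + ψ ξ' := by
    refine (ENNReal.ofReal_le_ofReal (hinge_le_mul_cost_add nrm hnrm κ h3 ξ ξ')).trans ?_
    refine ENNReal.ofReal_add_le.trans (le_of_eq ?_)
    rw [ENNReal.ofReal_mul hl, ENNReal.ofReal_max]
  refine iSup₂_le fun Q hQ => ?_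
  have hcoup (π : Measure (Sample P × Sample P))
      (hπ : π.map Prod.fst = Q ∧ π.map Prod.snd = empirical S) :
      ∫⁻ ξ, ENNReal.ofReal (hinge w ξ) ∂Q ≤
        ENNReal.ofReal l * ∫⁻ p, ENNReal.ofReal (cost nrm κ p.1 p.2) ∂π +
          ∫⁻ ξ, ψ ξ ∂(empirical S) := by
    rw [← hπ.1, ← hπ.2, lintegral_map (measurable_hinge w).ennreal_ofReal measurable_fst,
      lintegral_map hψm measurable_snd, ← lintegral_const_mul' _ _ ENNReal.ofReal_ne_top,
      ← lintegral_add_right _ (show Measurable fun p : Sample P × Sample P => ψ p.2 from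
        hψm.comp measurable_snd)]
    exact lintegral_mono fun p => hpt p.1 p.2
  have hmul : ENNReal.ofReal l * wasserstein nrm κ Q (empirical S) =
      ⨅ π : {π : Measure (Sample P × Sample P) // π ∈ {π : Measure (Sample P × Sample P) |
        π.map Prod.fst = Q ∧ π.map Prod.snd = empirical S}},
      ENNReal.ofReal l * ∫⁻ p, ENNReal.ofReal (cost nrm κ p.1 p.2) ∂π.1 := by
    -- without couplings the distance would be infinite; this matters for `l = 0`, as `0 * ⊤ = 0`
    have hne : Nonempty {π : Measure (Sample P × Sample P) // π ∈ {π : Measure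
        (Sample P × Sample P) | π.map Prod.fst = Q ∧ π.map Prod.snd = empirical S}} := by
      by_contra hcon
      have htop : wasserstein nrm κ Q (empirical S) = ⊤ := by
        rw [wasserstein, iInf_subtype']
        exact @iInf_of_empty _ _ _ (not_nonempty_iff.1 hcon) _
      exact ENNReal.ofReal_ne_top (top_le_iff.1 (htop ▸ hQ.2))
    rw [wasserstein, iInf_subtype']
    exact ENNReal.mul_iInf' (fun h => absurd h ENNReal.ofReal_ne_top) fun _ => hne
  have hQle : ∫⁻ ξ, ENNReal.ofReal (hinge w ξ) ∂Q ≤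
      ENNReal.ofReal l * wasserstein nrm κ Q (empirical S) + ∫⁻ ξ, ψ ξ ∂(empirical S) := by
    rw [hmul, ENNReal.iInf_add]
    exact le_iInf fun π => hcoup π.1 π.2
  have hψS : ∫⁻ ξ, ψ ξ ∂(empirical S) ≤ ENNReal.ofReal (1 / (N : ℝ) * ∑ n, s n) := by
    rw [lintegral_empirical, ← inv_natCast_mul_sum_ofReal hN s hs]
    gcongr with n
    exact max_le (ENNReal.ofReal_le_ofReal (h1 n)) (ENNReal.ofReal_le_ofReal (h2 n))
  have hsum : 0 ≤ ∑ n, s n := Finset.sum_nonneg fun n _ => hs n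
  rw [ENNReal.ofReal_add (by positivity) (by positivity), ENNReal.ofReal_mul hl]
  exact hQle.trans (add_le_add (mul_le_mul_right hQ.2 _) hψS)

/-! ### Discrete perturbations of the training set -/

/-- A plan that splits each training sample `S n` into atoms `Ξ n k` of relative weight `p n k`
gives a distribution in the Wasserstein ball as soon as its cost is at most `ε`; its expected loss
is then a lower bound of the worst-case risk. -/
theorem le_worstCaseRisk {P N : ℕ} {K : Type*} [Fintype K] (nrm : Seminorm ℝ (Feature P))
    {κ ε : ℝ} (hκ : 0 ≤ κ) (hN : 0 < N) (S : Fin N → Sample P) (w : Feature P)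
    (p : Fin N → K → ℝ) (hp : ∀ n k, 0 ≤ p n k) (hp1 : ∀ n, ∑ k, p n k = 1)
    (Ξ : Fin N → K → Sample P)
    (hcost : 1 / (N : ℝ) * ∑ n, ∑ k, p n k * cost nrm κ (Ξ n k) (S n) ≤ ε) :
    ENNReal.ofReal (1 / (N : ℝ) * ∑ n, ∑ k, p n k * hinge w (Ξ n k)) ≤
      worstCaseRisk nrm κ ε S w := by
  have hcost0 (ξ ξ' : Sample P) : 0 ≤ cost nrm κ ξ ξ' := by
    unfold cost
    split_ifs <;> positivity
  set π : Measure (Sample P × Sample P) :=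
    (N : ℝ≥0∞)⁻¹ • ∑ n, ∑ k, ENNReal.ofReal (p n k) • Measure.dirac (Ξ n k, S n) with hπ
  have hint (f : Sample P × Sample P → ℝ) (hf : ∀ x, 0 ≤ f x) :
      ∫⁻ x, ENNReal.ofReal (f x) ∂π =
        ENNReal.ofReal (1 / (N : ℝ) * ∑ n, ∑ k, p n k * f (Ξ n k, S n)) := by
    rw [← inv_natCast_mul_sum_ofReal hN _ fun n =>
      Finset.sum_nonneg fun k _ => mul_nonneg (hp n k) (hf _)]
    simp only [hπ, lintegral_smul_measure, lintegral_finsetSum_measure, lintegral_dirac,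
      smul_eq_mul]
    congr 1
    refine Finset.sum_congr rfl fun n _ => ?_
    rw [ENNReal.ofReal_sum_of_nonneg fun k _ => mul_nonneg (hp n k) (hf _)]
    exact Finset.sum_congr rfl fun k _ => (ENNReal.ofReal_mul (hp n k)).symm
  have hN0 : (N : ℝ≥0∞) ≠ 0 := by exact_mod_cast hN.ne'
  have hw (n : Fin N) : ∑ k, ENNReal.ofReal (p n k) = 1 := by
    rw [← ENNReal.ofReal_sum_of_nonneg fun k _ => hp n k, hp1, ENNReal.ofReal_one]
  have hsnd : π.map Prod.snd = empirical S := by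
    ext s hs
    rw [Measure.map_apply measurable_snd hs]
    simp only [hπ, empirical, Measure.smul_apply, Measure.finsetSum_apply, smul_eq_mul]
    congr 1
    refine Finset.sum_congr rfl fun n _ => ?_
    simp_rw [Measure.dirac_apply' _ (measurable_snd hs), Measure.dirac_apply' _ hs]
    rw [← one_mul (s.indicator _ _), ← hw n, Finset.sum_mul]
    rfl
  have hprob : IsProbabilityMeasure π := by
    refine ⟨?_⟩
    simp only [hπ, Measure.smul_apply, Measure.finsetSum_apply, smul_eq_mul, measure_univ,
      mul_one, hw]
    simp [ENNReal.inv_mul_cancel hN0]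
  have hmem : π.map Prod.fst ∈ ambiguitySet nrm κ ε S := by
    refine ⟨Measure.isProbabilityMeasure_map measurable_fst.aemeasurable, ?_⟩
    refine (iInf₂_le π ⟨rfl, hsnd⟩).trans ?_
    rw [hint (fun x => cost nrm κ x.1 x.2) fun x => hcost0 _ _]
    exact ENNReal.ofReal_le_ofReal hcost
  refine le_trans (le_of_eq ?_) (le_iSup₂_of_le _ hmem le_rfl)
  rw [lintegral_map (measurable_hinge w).ennreal_ofReal measurable_fst,
    hint (fun x => hinge w x.1) fun x => hinge_nonneg _ _]

/-- The worst-case risk dominates the loss after flipping the label of the `n`-th sample with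
probability `q n` and spending a remaining budget `r` on the features, in a direction `u` of norm
at most one. The second part is only reached in the limit: a fraction `t` of the mass is moved by
`r / t`, with `t → 0`, so that samples whose hinge starts out inactive lose only `O(t)`. -/
theorem flip_add_shift_le_worstCaseRisk {P N : ℕ} (nrm : Seminorm ℝ (Feature P)) {κ ε : ℝ}
    (hκ : 0 ≤ κ) (hN : 0 < N) (S : Fin N → Sample P) (w u : Feature P) (hu : nrm u ≤ 1)
    (q : Fin N → ℝ) (hq : ∀ n, 0 ≤ q n ∧ q n ≤ 1) {r : ℝ} (hr : 0 ≤ r)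
    (hbudget : 1 / (N : ℝ) * (κ * ∑ n, q n) + r ≤ ε) :
    ENNReal.ofReal (1 / (N : ℝ) * ∑ n, ((1 - q n) * hinge w (S n) +
      q n * hinge w (flipLabel (S n))) + r * inner ℝ w u) ≤ worstCaseRisk nrm κ ε S w := by
  have hN' : (0 : ℝ) < N := by exact_mod_cast hN
  set y : Fin N → ℝ := fun n => (((S n).2 : ℤ) : ℝ) with hy
  have hyy : ∀ n, y n * y n = 1 := fun n => by
    rcases Int.units_eq_one_or (S n).2 with h | h <;> simp [hy, h]
  set m : Fin N → ℝ := fun n => y n * inner ℝ w (S n).1 with hm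
  set V₀ : ℝ := 1 / (N : ℝ) * ∑ n, ((1 - q n) * hinge w (S n) +
    q n * hinge w (flipLabel (S n))) with hV₀
  set V₁ : ℝ := 1 / (N : ℝ) * ∑ n, ((1 - q n) * (1 - m n) + q n * (1 + m n)) with hV₁
  have hstep (t : ℝ) (ht : 0 < t) (ht1 : t < 1) :
      ENNReal.ofReal ((1 - t) * V₀ + t * V₁ + r * inner ℝ w u) ≤ worstCaseRisk nrm κ ε S w := by
    -- the first component of an index tells whether the label is flipped, the second whether the
    -- features are shifted
    have hrt : t * (r / t) = r := mul_div_cancel₀ r ht.ne'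
    have hrt0 : 0 ≤ r / t := div_nonneg hr ht.le
    have ht1' : 0 ≤ 1 - t := by linarith
    let p : Fin N → Bool × Bool → ℝ := fun n k =>
      (if k.1 then q n else 1 - q n) * (if k.2 then t else 1 - t)
    let Ξ : Fin N → Bool × Bool → Sample P := fun n k =>
      ((S n).1 - (if k.2 then (if k.1 then - y n else y n) * (r / t) else 0) • u,
        if k.1 then -(S n).2 else (S n).2)
    have hne : ∀ n, -(S n).2 ≠ (S n).2 := fun n => by
      rcases Int.units_eq_one_or (S n).2 with h | h <;> rw [h] <;> decide
    have hyabs : ∀ n, |y n| = 1 := fun n => by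
      rcases Int.units_eq_one_or (S n).2 with h | h <;> simp [hy, h]
    have hcost (n : Fin N) :
        ∑ k, p n k * cost nrm κ (Ξ n k) (S n) ≤ κ * q n + r := by
      have hn : r / t * nrm u ≤ r / t := mul_le_of_le_one_right hrt0 hu
      have e : ∑ k, p n k * cost nrm κ (Ξ n k) (S n) = κ * q n + t * (r / t * nrm u) := by
        simp only [p, Ξ, cost, Fintype.sum_prod_type, Fintype.sum_bool, sub_sub_cancel_left,
          map_neg_eq_map, map_smul_eq_mul, Real.norm_eq_abs, abs_mul, abs_neg, hyabs,
          abs_of_nonneg hrt0, if_true, Bool.false_eq_true, if_false, ne_eq, hne,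
          not_false_eq_true, not_true_eq_false, abs_zero]
        ring
      rw [e]
      linarith [mul_le_mul_of_nonneg_left hn ht.le]
    have hloss (n : Fin N) :
        (1 - t) * ((1 - q n) * hinge w (S n) + q n * hinge w (flipLabel (S n))) +
          t * ((1 - q n) * (1 - m n) + q n * (1 + m n)) + r * inner ℝ w u ≤
        ∑ k, p n k * hinge w (Ξ n k) := by
      have h1 : 1 - m n + r / t * inner ℝ w u ≤ hinge w (Ξ n (false, true)) := by
        refine le_trans (le_of_eq ?_) (le_hinge w _)
        simp only [Ξ, inner_sub_right, real_inner_smul_right, if_true, Bool.false_eq_true,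
          if_false, hm]
        linear_combination (-(r / t) * inner ℝ w u) * hyy n
      have h2 : 1 + m n + r / t * inner ℝ w u ≤ hinge w (Ξ n (true, true)) := by
        refine le_trans (le_of_eq ?_) (le_hinge w _)
        simp only [Ξ, inner_sub_right, real_inner_smul_right, if_true, hm, Units.val_neg,
          Int.cast_neg]
        linear_combination (-(r / t) * inner ℝ w u) * hyy n
      have e1 : Ξ n (false, false) = S n := by simp [Ξ]
      have e2 : Ξ n (true, false) = flipLabel (S n) := by simp [Ξ, flipLabel]
      have g1 := mul_le_mul_of_nonneg_left h1
        (mul_nonneg (sub_nonneg.2 (hq n).2) ht.le)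
      have g2 := mul_le_mul_of_nonneg_left h2 (mul_nonneg (hq n).1 ht.le)
      simp only [Fintype.sum_prod_type, Fintype.sum_bool, e1, e2]
      simp only [p, if_true, Bool.false_eq_true, if_false]
      have e3 : t * (r / t * inner ℝ w u) = r * inner ℝ w u := by rw [← mul_assoc, hrt]
      linear_combination g1 + g2 - e3
    have hmain := le_worstCaseRisk (ε := ε) nrm hκ hN S w p (fun n k => ?_) (fun n => ?_) Ξ ?_
    · refine le_trans (ENNReal.ofReal_le_ofReal ?_) hmain
      have h := mul_le_mul_of_nonneg_left (Finset.sum_le_sum fun n (_ : n ∈ Finset.univ) =>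
        hloss n) (one_div_nonneg.2 hN'.le)
      refine le_trans (le_of_eq ?_) h
      simp only [hV₀, hV₁, Finset.sum_add_distrib, ← Finset.mul_sum, Finset.sum_const,
        Finset.card_univ, Fintype.card_fin, nsmul_eq_mul]
      field_simp
    · refine mul_nonneg ?_ ?_
      · split_ifs
        exacts [(hq n).1, sub_nonneg.2 (hq n).2]
      · split_ifs
        exacts [ht.le, ht1']
    · simp only [p, Fintype.sum_prod_type, Fintype.sum_bool, if_true, Bool.false_eq_true, if_false]
      ring
    · have h := mul_le_mul_of_nonneg_left (Finset.sum_le_sum fun n (_ : n ∈ Finset.univ) =>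
        hcost n) (one_div_nonneg.2 hN'.le)
      refine h.trans (le_trans (le_of_eq ?_) hbudget)
      simp only [Finset.sum_add_distrib, ← Finset.mul_sum, Finset.sum_const, Finset.card_univ,
        Fintype.card_fin, nsmul_eq_mul]
      field_simp
  have hlim : Filter.Tendsto
      (fun t : ℝ => ENNReal.ofReal ((1 - t) * V₀ + t * V₁ + r * inner ℝ w u))
      (nhdsWithin 0 (Set.Ioi 0)) (nhds (ENNReal.ofReal (V₀ + r * inner ℝ w u))) := by
    have hc : Continuous fun t : ℝ =>
        ENNReal.ofReal ((1 - t) * V₀ + t * V₁ + r * inner ℝ w u) :=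
      ENNReal.continuous_ofReal.comp (by fun_prop)
    have h := hc.tendsto 0
    simp only [sub_zero, one_mul, zero_mul, add_zero] at h
    exact h.mono_left nhdsWithin_le_nhds
  refine le_of_tendsto hlim ?_
  filter_upwards [Ioo_mem_nhdsGT (zero_lt_one' ℝ)] with t ht
  exact hstep t ht.1 ht.2

/-! ### A fractional knapsack problem -/


/-- Optimality system of the fractional knapsack problem that decides which labels to flip:
`a i` is the gain of a full flip, `κ` its cost, `c` the budget and `L` the value of a unit of unused
budget. The multiplier `l` is the least admissible breakpoint of the piecewise linear dual
function. -/
theorem exists_knapsack_multiplier {ι : Type*} [Fintype ι] (a : ι → ℝ) {κ c : ℝ} (L : ℝ)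
    (hκ : 0 ≤ κ) (hc : 0 ≤ c) :
    ∃ l, L ≤ l ∧ ∃ q : ι → ℝ, (∀ i, 0 ≤ q i ∧ q i ≤ 1) ∧ κ * ∑ i, q i ≤ c ∧
      (l - L) * (c - κ * ∑ i, q i) = 0 ∧ ∀ i, q i * (a i - κ * l) = max 0 (a i - κ * l) := by
  classical
  rcases hκ.eq_or_lt with rfl | hκ
  · refine ⟨L, le_rfl, fun i => if 0 < a i then 1 else 0, fun i => ?_, by simpa using hc,
      by simp, fun i => ?_⟩
    · dsimp only
      split_ifs <;> norm_num
    · dsimp only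
      split_ifs with h
      · simp [h.le]
      · simp [not_lt.1 h]
  set b : ι → ℝ := fun i => a i / κ with hb
  have hab : ∀ i, a i = κ * b i := fun i => by simp only [hb]; field_simp
  set U : Finset ℝ := insert L (Finset.univ.image b) with hU
  have hLU : L ∈ U := Finset.mem_insert_self _ _
  have hbU : ∀ i, b i ∈ U := fun i =>
    Finset.mem_insert_of_mem (Finset.mem_image_of_mem b (Finset.mem_univ i))
  -- `A t` counts the gains above `κ t`, and `B t` those at least `κ t`
  set A : ℝ → ℝ := fun t => ∑ i, if t < b i then (1 : ℝ) else 0 with hA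
  set B : ℝ → ℝ := fun t => ∑ i, if t ≤ b i then (1 : ℝ) else 0 with hB
  set T : Finset ℝ := U.filter fun t => L ≤ t ∧ κ * A t ≤ c with hT
  have hTne : T.Nonempty := by
    refine ⟨U.max' ⟨L, hLU⟩, Finset.mem_filter.2 ⟨U.max'_mem _, U.le_max' _ hLU, ?_⟩⟩
    have : A (U.max' ⟨L, hLU⟩) = 0 :=
      Finset.sum_eq_zero fun i _ => if_neg (not_lt.2 (U.le_max' _ (hbU i)))
    simpa [this] using hc
  obtain ⟨l, hlT, hmin⟩ := T.exists_min_image id hTne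
  simp only [id] at hmin
  obtain ⟨-, hLl, hlc⟩ := Finset.mem_filter.1 hlT
  -- gains equal to `κ l` may be flipped with any probability `θ`; it remains to fit the budget
  have key : ∀ θ : ℝ, 0 ≤ θ → θ ≤ 1 → κ * ((1 - θ) * A l + θ * B l) ≤ c →
      (l - L) * (c - κ * ((1 - θ) * A l + θ * B l)) = 0 →
      ∃ l, L ≤ l ∧ ∃ q : ι → ℝ, (∀ i, 0 ≤ q i ∧ q i ≤ 1) ∧ κ * ∑ i, q i ≤ c ∧
      (l - L) * (c - κ * ∑ i, q i) = 0 ∧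
      ∀ i, q i * (a i - κ * l) = max 0 (a i - κ * l) := by
    intro θ h0 h1 h2 h3
    have hsum : ∑ i, ((1 - θ) * (if l < b i then (1 : ℝ) else 0) +
        θ * (if l ≤ b i then (1 : ℝ) else 0)) = (1 - θ) * A l + θ * B l := by
      rw [Finset.sum_add_distrib, ← Finset.mul_sum, ← Finset.mul_sum]
    refine ⟨l, hLl, fun i => (1 - θ) * (if l < b i then (1 : ℝ) else 0) +
        θ * (if l ≤ b i then (1 : ℝ) else 0), fun i => ?_, by rwa [hsum], by rwa [hsum],
        fun i => ?_⟩
    · rcases lt_trichotomy l (b i) with h | h | h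
      · simp [h, h.le]
      · simp [h, h0, h1]
      · simp [h.not_gt, h.not_ge]
    · rw [hab i, ← mul_sub]
      rcases lt_trichotomy l (b i) with h | h | h
      · have : 0 ≤ κ * (b i - l) := mul_nonneg hκ.le (sub_nonneg.2 h.le)
        simp [h, h.le, max_eq_right this]
      · simp [h]
      · have : κ * (b i - l) ≤ 0 := mul_nonpos_of_nonneg_of_nonpos hκ.le (sub_nonpos.2 h.le)
        simp [h.not_gt, h.not_ge, max_eq_left this]
  rcases hLl.eq_or_lt with hL | hL
  · exact key 0 le_rfl zero_le_one (by simpa using hlc) (by simp [hL])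
  · -- the preceding breakpoint is not admissible, so `κ * B l` exceeds the budget
    have hVne : (U.filter fun t => t < l).Nonempty := ⟨L, Finset.mem_filter.2 ⟨hLU, hL⟩⟩
    obtain ⟨m, hm, hmax⟩ := (U.filter fun t => t < l).exists_max_image id hVne
    simp only [id] at hmax
    obtain ⟨hmU, hml⟩ := Finset.mem_filter.1 hm
    have hLm : L ≤ m := hmax L (Finset.mem_filter.2 ⟨hLU, hL⟩)
    have hmB : A m = B l := by
      refine Finset.sum_congr rfl fun i _ => ?_
      have : m < b i ↔ l ≤ b i :=
        ⟨fun h => le_of_not_gt fun h' => absurd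
          (hmax (b i) (Finset.mem_filter.2 ⟨hbU i, h'⟩)) (not_le.2 h), fun h => hml.trans_le h⟩
      simp only [this]
    have hBc : c < κ * B l := by
      rw [← hmB]
      by_contra h
      exact absurd (hmin m (Finset.mem_filter.2 ⟨hmU, hLm, not_lt.1 h⟩)) (not_le.2 hml)
    have hden : 0 < κ * B l - κ * A l := by linarith
    have hθ : κ * ((1 - (c - κ * A l) / (κ * B l - κ * A l)) * A l +
        (c - κ * A l) / (κ * B l - κ * A l) * B l) = c := by
      have := div_mul_cancel₀ (c - κ * A l) hden.ne'
      linear_combination this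
    refine key ((c - κ * A l) / (κ * B l - κ * A l)) (div_nonneg (by linarith) hden.le)
      ((div_le_one hden).2 (by linarith)) hθ.le ?_
    rw [hθ]
    ring

/-! ### Strong duality -/

/-- Strong duality, with attainment of the dual optimum: every model extends to a feasible point
of the client program whose value is at most the worst-case risk. The knapsack multiplier is the
dual variable; complementarity shows that the corresponding flips and feature shift reach the
dual value. -/
theorem exists_feasible_le_worstCaseRisk {P N : ℕ} (nrm : Seminorm ℝ (Feature P))
    {κ ε : ℝ} (hκ : 0 ≤ κ) (hε : 0 ≤ ε) (hN : 0 < N)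
    (S : Fin N → Sample P) (w : Feature P) :
    ∃ (l : ℝ) (s : Fin N → ℝ), ((w, l, s) : ClientVar P N) ∈ clientFeasible nrm κ S ∧
      ENNReal.ofReal (l * ε + 1 / (N : ℝ) * ∑ n, s n) ≤ worstCaseRisk nrm κ ε S w := by
  have hN' : (0 : ℝ) < N := by exact_mod_cast hN
  obtain ⟨l, hl, q, hq, hqc, hcs, hmax⟩ := exists_knapsack_multiplier
    (fun n => hinge w (flipLabel (S n)) - hinge w (S n)) (dualNorm nrm w) hκ
    (mul_nonneg hN'.le hε)
  refine ⟨l, fun n => max (hinge w (S n)) (hinge w (flipLabel (S n)) - κ * l),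
    ⟨fun n => le_max_left _ _, fun n => le_max_right _ _, hl⟩, ?_⟩
  set r : ℝ := ε - 1 / (N : ℝ) * (κ * ∑ n, q n) with hr
  have hNr : N * r = N * ε - κ * ∑ n, q n := by
    rw [hr]
    field_simp
  have hr0 : 0 ≤ r := by
    refine le_of_mul_le_mul_left ?_ hN'
    rw [hNr]
    linarith
  have hlr : (l - dualNorm nrm w) * r = 0 := by
    rw [← hNr] at hcs
    have : (N : ℝ) * ((l - dualNorm nrm w) * r) = 0 := by linear_combination hcs
    exact (mul_eq_zero.1 this).resolve_left hN'.ne'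
  set V : ℝ := 1 / (N : ℝ) * ∑ n, ((1 - q n) * hinge w (S n) +
    q n * hinge w (flipLabel (S n))) with hV
  have hval : l * ε + 1 / (N : ℝ) * ∑ n, max (hinge w (S n))
      (hinge w (flipLabel (S n)) - κ * l) = V + r * dualNorm nrm w := by
    have hs (n : Fin N) : max (hinge w (S n)) (hinge w (flipLabel (S n)) - κ * l) =
        ((1 - q n) * hinge w (S n) + q n * hinge w (flipLabel (S n))) - κ * l * q n := by
      have h := hmax n
      rw [← sub_self (hinge w (S n)), sub_right_comm, max_sub_sub_right] at h
      linear_combination -h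
    simp only [hs]
    rw [Finset.sum_sub_distrib, ← Finset.mul_sum, mul_sub, ← hV]
    linear_combination hlr - l * hr
  rw [hval]
  have hlow (u : Feature P) (hu : nrm u ≤ 1) :
      ENNReal.ofReal (V + r * inner ℝ w u) ≤ worstCaseRisk nrm κ ε S w :=
    flip_add_shift_le_worstCaseRisk nrm hκ hN S w u hu q hq hr0 (by rw [hr]; linarith)
  rcases eq_or_ne (worstCaseRisk nrm κ ε S w) ⊤ with htop | htop
  · simp [htop]
  rw [ENNReal.ofReal_le_iff_le_toReal htop]
  rcases hr0.eq_or_lt with h0 | hpos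
  · have h := (ENNReal.ofReal_le_iff_le_toReal htop).1 (hlow 0 (by simp))
    rw [← h0] at h ⊢
    linarith
  · have h : dualNorm nrm w ≤ ((worstCaseRisk nrm κ ε S w).toReal - V) / r :=
      dualNorm_le nrm fun u hu => by
        have h := (ENNReal.ofReal_le_iff_le_toReal htop).1 (hlow u hu)
        rw [le_div_iff₀ hpos]
        linarith
    rw [le_div_iff₀ hpos] at h
    linarith

/-! ### Convexity of the client program -/

theorem strictConvexOn_quadratic {P : ℕ} {ρ : ℝ} (hρ : 0 < ρ) (w μ : Feature P) :
    StrictConvexOn ℝ Set.univ fun v : Feature P => ρ / 2 * ‖v - w + μ‖ ^ 2 := by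
  have h : StrongConvexOn Set.univ ρ fun v : Feature P => ρ / 2 * ‖v - w + μ‖ ^ 2 := by
    rw [strongConvexOn_iff_convex]
    refine ⟨convex_univ, fun v _ v' _ a b _ _ hab => le_of_eq ?_⟩
    have e (v : Feature P) : ρ / 2 * ‖v - w + μ‖ ^ 2 - ρ / 2 * ‖v‖ ^ 2 =
        ρ * inner ℝ v (μ - w) + ρ / 2 * ‖μ - w‖ ^ 2 := by
      rw [show v - w + μ = v + (μ - w) by abel, norm_add_sq_real]
      ring
    simp only [e, inner_add_left, real_inner_smul_left, smul_eq_mul]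
    linear_combination -(ρ / 2 * ‖μ - w‖ ^ 2) * hab
  refine UniformConvexOn.strictConvexOn h fun r hr => ?_
  positivity

theorem convexOn_clientObjective {P N : ℕ} (ε : ℝ) {ρ : ℝ} (hρ : 0 < ρ) (w μ : Feature P) :
    ConvexOn ℝ Set.univ (clientObjective ε ρ w μ : ClientVar P N → ℝ) := by
  have hlin : ConvexOn ℝ Set.univ fun z : ClientVar P N =>
      z.2.1 * ε + (1 / (N : ℝ)) * ∑ n, z.2.2 n := by
    refine ⟨convex_univ, fun z _ z' _ a b _ _ _ => le_of_eq ?_⟩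
    simp only [Prod.snd_add, Prod.smul_snd, Prod.fst_add, Prod.smul_fst, Pi.add_apply,
      Pi.smul_apply, smul_eq_mul, Finset.sum_add_distrib, ← Finset.mul_sum]
    ring
  exact hlin.add
    ((strictConvexOn_quadratic hρ w μ).convexOn.comp_linearMap
      (LinearMap.fst ℝ (Feature P) (ℝ × (Fin N → ℝ))))

theorem convexOn_hinge_sub {P N : ℕ} (ξ : Sample P) (n : Fin N) :
    ConvexOn ℝ Set.univ (fun z : ClientVar P N => hinge z.1 ξ - z.2.2 n) :=
  ((convexOn_hinge ξ).comp_linearMap (LinearMap.fst ℝ (Feature P) (ℝ × (Fin N → ℝ)))).sub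
    (((LinearMap.proj n).comp ((LinearMap.snd ℝ ℝ (Fin N → ℝ)).comp
      (LinearMap.snd ℝ (Feature P) (ℝ × (Fin N → ℝ))))).concaveOn convex_univ)

theorem convexOn_hinge_sub_mul_sub {P N : ℕ} (κ : ℝ) (ξ : Sample P) (n : Fin N) :
    ConvexOn ℝ Set.univ (fun z : ClientVar P N => hinge z.1 ξ - κ * z.2.1 - z.2.2 n) := by
  have h := (convexOn_hinge_sub ξ n).sub ((κ • (LinearMap.fst ℝ ℝ (Fin N → ℝ)).comp
      (LinearMap.snd ℝ (Feature P) (ℝ × (Fin N → ℝ)))).concaveOn convex_univ)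
  exact h.congr fun z _ => sub_right_comm (hinge z.1 ξ) (z.2.2 n) (κ * z.2.1)

theorem convexOn_dualNorm_sub {P N : ℕ} (nrm : Seminorm ℝ (Feature P))
    (hnrm : ∀ x, nrm x = 0 → x = 0) :
    ConvexOn ℝ Set.univ (fun z : ClientVar P N => dualNorm nrm z.1 - z.2.1) :=
  ((convexOn_dualNorm nrm hnrm).comp_linearMap
    (LinearMap.fst ℝ (Feature P) (ℝ × (Fin N → ℝ)))).sub
    (((LinearMap.fst ℝ ℝ (Fin N → ℝ)).comp
      (LinearMap.snd ℝ (Feature P) (ℝ × (Fin N → ℝ)))).concaveOn convex_univ)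

theorem convex_clientFeasible {P N : ℕ} (nrm : Seminorm ℝ (Feature P))
    (hnrm : ∀ x, nrm x = 0 → x = 0) (κ : ℝ) (S : Fin N → Sample P) :
    Convex ℝ (clientFeasible nrm κ S) := by
  have h1 := convex_iInter fun n => (convexOn_hinge_sub (S n) n).convex_le 0
  have h2 := convex_iInter fun n =>
    (convexOn_hinge_sub_mul_sub κ (flipLabel (S n)) n).convex_le 0
  have h3 := (convexOn_dualNorm_sub (N := N) nrm hnrm).convex_le 0
  convert h1.inter (h2.inter h3) using 1
  ext z
  simp [clientFeasible]

/-! ### The reduced local objective -/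

/-- The local augmented Lagrangian as a real-valued function of the local model. -/
noncomputable def realLagrangian {P N : ℕ} (nrm : Seminorm ℝ (Feature P)) (κ ε ρ : ℝ)
    (S : Fin N → Sample P) (w μ v : Feature P) : ℝ :=
  (worstCaseRisk nrm κ ε S v).toReal + ρ / 2 * ‖v - w + μ‖ ^ 2

theorem worstCaseRisk_ne_top {P N : ℕ} (nrm : Seminorm ℝ (Feature P))
    (hnrm : ∀ x, nrm x = 0 → x = 0) {κ ε : ℝ} (hκ : 0 ≤ κ) (hε : 0 ≤ ε) (hN : 0 < N)
    (S : Fin N → Sample P) (v : Feature P) : worstCaseRisk nrm κ ε S v ≠ ⊤ := by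
  obtain ⟨l, s, hz, -⟩ := exists_feasible_le_worstCaseRisk nrm hκ hε hN S v
  exact ne_top_of_le_ne_top ENNReal.ofReal_ne_top
    (worstCaseRisk_le nrm hnrm hε hN S (z := (v, l, s)) hz)

theorem localLagrangian_eq {P N : ℕ} (nrm : Seminorm ℝ (Feature P))
    (hnrm : ∀ x, nrm x = 0 → x = 0) {κ ε ρ : ℝ} (hκ : 0 ≤ κ) (hε : 0 ≤ ε) (hρ : 0 < ρ)
    (hN : 0 < N) (S : Fin N → Sample P) (w μ v : Feature P) :
    localLagrangian nrm κ ε ρ S w μ v = ENNReal.ofReal (realLagrangian nrm κ ε ρ S w μ v) := by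
  rw [localLagrangian, realLagrangian, ENNReal.ofReal_add ENNReal.toReal_nonneg (by positivity),
    ENNReal.ofReal_toReal (worstCaseRisk_ne_top nrm hnrm hκ hε hN S v)]

theorem realLagrangian_nonneg {P N : ℕ} (nrm : Seminorm ℝ (Feature P)) (κ ε : ℝ) {ρ : ℝ}
    (hρ : 0 < ρ) (S : Fin N → Sample P) (w μ v : Feature P) :
    0 ≤ realLagrangian nrm κ ε ρ S w μ v :=
  add_nonneg ENNReal.toReal_nonneg (by positivity)

/-- The value of a feasible point without the quadratic term bounds the real worst-case risk. -/
theorem toReal_worstCaseRisk_le {P N : ℕ} (nrm : Seminorm ℝ (Feature P))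
    (hnrm : ∀ x, nrm x = 0 → x = 0) {κ ε : ℝ} (hε : 0 ≤ ε) (hN : 0 < N) (S : Fin N → Sample P)
    {z : ClientVar P N} (hz : z ∈ clientFeasible nrm κ S) :
    (worstCaseRisk nrm κ ε S z.1).toReal ≤ z.2.1 * ε + 1 / (N : ℝ) * ∑ n, z.2.2 n := by
  refine ENNReal.toReal_le_of_le_ofReal ?_ (worstCaseRisk_le nrm hnrm hε hN S hz)
  have hl : 0 ≤ z.2.1 := (dualNorm_nonneg nrm hnrm z.1).trans hz.2.2
  have hs : 0 ≤ ∑ n, z.2.2 n := Finset.sum_nonneg fun n _ => (hinge_nonneg _ _).trans (hz.1 n)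
  positivity

theorem exists_feasible_eq_toReal {P N : ℕ} (nrm : Seminorm ℝ (Feature P))
    (hnrm : ∀ x, nrm x = 0 → x = 0) {κ ε : ℝ} (hκ : 0 ≤ κ) (hε : 0 ≤ ε) (hN : 0 < N)
    (S : Fin N → Sample P) (v : Feature P) :
    ∃ (l : ℝ) (s : Fin N → ℝ), ((v, l, s) : ClientVar P N) ∈ clientFeasible nrm κ S ∧
      l * ε + 1 / (N : ℝ) * ∑ n, s n = (worstCaseRisk nrm κ ε S v).toReal := by
  obtain ⟨l, s, hz, hle⟩ := exists_feasible_le_worstCaseRisk nrm hκ hε hN S v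
  refine ⟨l, s, hz, le_antisymm ?_
    (toReal_worstCaseRisk_le nrm hnrm hε hN S (z := (v, l, s)) hz)⟩
  exact (ENNReal.ofReal_le_iff_le_toReal (worstCaseRisk_ne_top nrm hnrm hκ hε hN S v)).1 hle

theorem realLagrangian_le_clientObjective {P N : ℕ} (nrm : Seminorm ℝ (Feature P))
    (hnrm : ∀ x, nrm x = 0 → x = 0) {κ ε : ℝ} (hε : 0 ≤ ε) (ρ : ℝ) (hN : 0 < N)
    (S : Fin N → Sample P) (w μ : Feature P) {z : ClientVar P N}
    (hz : z ∈ clientFeasible nrm κ S) :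
    realLagrangian nrm κ ε ρ S w μ z.1 ≤ clientObjective ε ρ w μ z :=
  add_le_add_left (toReal_worstCaseRisk_le nrm hnrm hε hN S hz) _

theorem exists_clientObjective_eq {P N : ℕ} (nrm : Seminorm ℝ (Feature P))
    (hnrm : ∀ x, nrm x = 0 → x = 0) {κ ε : ℝ} (hκ : 0 ≤ κ) (hε : 0 ≤ ε) (ρ : ℝ) (hN : 0 < N)
    (S : Fin N → Sample P) (w μ v : Feature P) :
    ∃ (l : ℝ) (s : Fin N → ℝ), ((v, l, s) : ClientVar P N) ∈ clientFeasible nrm κ S ∧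
      clientObjective ε ρ w μ (v, l, s) = realLagrangian nrm κ ε ρ S w μ v := by
  obtain ⟨l, s, hz, h⟩ := exists_feasible_eq_toReal nrm hnrm hκ hε hN S v
  exact ⟨l, s, hz, congrArg (· + ρ / 2 * ‖v - w + μ‖ ^ 2) h⟩

/-- The worst-case risk is a partial minimum of a jointly convex function. -/
theorem convexOn_toReal_worstCaseRisk {P N : ℕ} (nrm : Seminorm ℝ (Feature P))
    (hnrm : ∀ x, nrm x = 0 → x = 0) {κ ε : ℝ} (hκ : 0 ≤ κ) (hε : 0 ≤ ε) (hN : 0 < N)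
    (S : Fin N → Sample P) :
    ConvexOn ℝ Set.univ fun v => (worstCaseRisk nrm κ ε S v).toReal := by
  refine ⟨convex_univ, fun v _ v' _ a b ha hb hab => ?_⟩
  obtain ⟨l, s, hz, h⟩ := exists_feasible_eq_toReal nrm hnrm hκ hε hN S v
  obtain ⟨l', s', hz', h'⟩ := exists_feasible_eq_toReal nrm hnrm hκ hε hN S v'
  have hle := toReal_worstCaseRisk_le nrm hnrm hε hN S
    (convex_clientFeasible nrm hnrm κ S hz hz' ha hb hab)
  refine hle.trans (le_of_eq ?_)
  simp only [← h, ← h', Prod.snd_add, Prod.smul_snd, Prod.fst_add, Prod.smul_fst, Pi.add_apply,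
    Pi.smul_apply, smul_eq_mul, Finset.sum_add_distrib, ← Finset.mul_sum]
  ring

theorem strictConvexOn_realLagrangian {P N : ℕ} (nrm : Seminorm ℝ (Feature P))
    (hnrm : ∀ x, nrm x = 0 → x = 0) {κ ε ρ : ℝ} (hκ : 0 ≤ κ) (hε : 0 ≤ ε) (hρ : 0 < ρ)
    (hN : 0 < N) (S : Fin N → Sample P) (w μ : Feature P) :
    StrictConvexOn ℝ Set.univ (realLagrangian nrm κ ε ρ S w μ) :=
  (convexOn_toReal_worstCaseRisk nrm hnrm hκ hε hN S).add_strictConvexOn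
    (strictConvexOn_quadratic hρ w μ)

theorem exists_forall_realLagrangian_le {P N : ℕ} (nrm : Seminorm ℝ (Feature P))
    (hnrm : ∀ x, nrm x = 0 → x = 0) {κ ε ρ : ℝ} (hκ : 0 ≤ κ) (hε : 0 ≤ ε) (hρ : 0 < ρ)
    (hN : 0 < N) (S : Fin N → Sample P) (w μ : Feature P) :
    ∃ v₀, ∀ v, realLagrangian nrm κ ε ρ S w μ v₀ ≤ realLagrangian nrm κ ε ρ S w μ v := by
  have hcont : Continuous (realLagrangian nrm κ ε ρ S w μ) :=
    continuousOn_univ.1 ((strictConvexOn_realLagrangian nrm hnrm hκ hε hρ hN S w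
      μ).convexOn.continuousOn isOpen_univ)
  refine hcont.exists_forall_le ?_
  have hnorm : Filter.Tendsto (fun v : Feature P => ‖v - w + μ‖) (Filter.cocompact _)
      Filter.atTop := by
    refine Filter.tendsto_atTop_mono (f := fun v => ‖v‖ - ‖w - μ‖) (fun v => ?_)
      (Filter.tendsto_atTop_add_const_right _ _ tendsto_norm_cocompact_atTop)
    rw [show v - w + μ = v - (w - μ) by abel]
    exact norm_sub_norm_le _ _
  have hquad : Filter.Tendsto (fun v : Feature P => ρ / 2 * ‖v - w + μ‖ ^ 2)
      (Filter.cocompact _) Filter.atTop :=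
    ((Filter.tendsto_pow_atTop two_ne_zero).comp hnorm).const_mul_atTop (half_pos hρ)
  exact Filter.tendsto_atTop_mono
    (fun v => le_add_of_nonneg_left ENNReal.toReal_nonneg) hquad

/-! ### Optimal solutions of the client program -/

theorem exists_isClientOptimal_iff {P N : ℕ} (nrm : Seminorm ℝ (Feature P))
    (hnrm : ∀ x, nrm x = 0 → x = 0) {κ ε : ℝ} (hκ : 0 ≤ κ) (hε : 0 ≤ ε) (ρ : ℝ)
    (hN : 0 < N) (S : Fin N → Sample P) (w μ v : Feature P) :
    (∃ (l : ℝ) (s : Fin N → ℝ), IsClientOptimal nrm κ ε ρ S w μ (v, l, s)) ↔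
      ∀ v', realLagrangian nrm κ ε ρ S w μ v ≤ realLagrangian nrm κ ε ρ S w μ v' := by
  constructor
  · rintro ⟨l, s, hz, hmin⟩ v'
    obtain ⟨l', s', hz', h'⟩ := exists_clientObjective_eq nrm hnrm hκ hε ρ hN S w μ v'
    exact (realLagrangian_le_clientObjective nrm hnrm hε ρ hN S w μ hz).trans (h' ▸ hmin hz')
  · intro hv
    obtain ⟨l, s, hz, h⟩ := exists_clientObjective_eq nrm hnrm hκ hε ρ hN S w μ v
    refine ⟨l, s, hz, fun z' hz' => ?_⟩
    rw [Set.mem_ofPred_eq, h]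
    exact (hv z'.1).trans (realLagrangian_le_clientObjective nrm hnrm hε ρ hN S w μ hz')

theorem isMinOn_localLagrangian_iff {P N : ℕ} (nrm : Seminorm ℝ (Feature P))
    (hnrm : ∀ x, nrm x = 0 → x = 0) {κ ε ρ : ℝ} (hκ : 0 ≤ κ) (hε : 0 ≤ ε) (hρ : 0 < ρ)
    (hN : 0 < N) (S : Fin N → Sample P) (w μ v : Feature P) :
    IsMinOn (localLagrangian nrm κ ε ρ S w μ) Set.univ v ↔
      ∀ v', realLagrangian nrm κ ε ρ S w μ v ≤ realLagrangian nrm κ ε ρ S w μ v' := by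
  simp only [isMinOn_univ_iff, localLagrangian_eq nrm hnrm hκ hε hρ hN S w μ,
    ENNReal.ofReal_le_ofReal_iff (realLagrangian_nonneg nrm κ ε hρ S w μ _)]

/-- As a function of one block, the global Lagrangian is a multiple of the local one plus a
constant. -/
theorem augLagrangian_update {P G : ℕ} {N : Fin G → ℕ} (nrm : Seminorm ℝ (Feature P)) (κ : ℝ)
    (ε α : Fin G → ℝ) (ρ : ℝ) (S : (g : Fin G) → Fin (N g) → Sample P)
    (wloc : Fin G → Feature P) (w : Feature P) (μ : Fin G → Feature P) (g : Fin G)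
    (v : Feature P) :
    augLagrangian nrm κ ε α ρ S (Function.update wloc g v) w μ =
      ENNReal.ofReal (α g) * localLagrangian nrm κ (ε g) ρ (S g) w (μ g) v +
        ∑ h ∈ Finset.univ.erase g,
          ENNReal.ofReal (α h) * localLagrangian nrm κ (ε h) ρ (S h) w (μ h) (wloc h) := by
  rw [augLagrangian, ← Finset.add_sum_erase _ _ (Finset.mem_univ g), Function.update_self]
  congr 1
  refine Finset.sum_congr rfl fun h hh => ?_
  rw [Function.update_of_ne (Finset.ne_of_mem_erase hh)]

end FDRSVM

theorem proposition4 {P G : ℕ} {N : Fin G → ℕ}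
    (nrm : Seminorm ℝ (FDRSVM.Feature P)) (hnrm : ∀ x, nrm x = 0 → x = 0)
    (κ : ℝ) (hκ : 0 ≤ κ) (ρ : ℝ) (hρ : 0 < ρ)
    (ε : Fin G → ℝ) (hε : ∀ g, 0 ≤ ε g)
    (α : Fin G → ℝ) (hα : ∀ g, 0 ≤ α g) (hα1 : ∑ g, α g = 1)
    (hN : ∀ g, 0 < N g) (S : (g : Fin G) → Fin (N g) → FDRSVM.Sample P)
    (w : FDRSVM.Feature P) (μ : Fin G → FDRSVM.Feature P) (g : Fin G) :
    -- the client program is convex: objective, constraint functions, feasible set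
    (ConvexOn ℝ Set.univ
        (FDRSVM.clientObjective (ε g) ρ w (μ g) : FDRSVM.ClientVar P (N g) → ℝ) ∧
      (∀ n, ConvexOn ℝ Set.univ
        (fun z : FDRSVM.ClientVar P (N g) => FDRSVM.hinge z.1 (S g n) - z.2.2 n)) ∧
      (∀ n, ConvexOn ℝ Set.univ
        (fun z : FDRSVM.ClientVar P (N g) =>
          FDRSVM.hinge z.1 (FDRSVM.flipLabel (S g n)) - κ * z.2.1 - z.2.2 n)) ∧
      ConvexOn ℝ Set.univ
        (fun z : FDRSVM.ClientVar P (N g) => FDRSVM.dualNorm nrm z.1 - z.2.1) ∧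
      Convex ℝ (FDRSVM.clientFeasible nrm κ (S g))) ∧
    -- both problems attain their minimum, with the same finite optimal value
    (∃ J : ℝ≥0,
      IsLeast (FDRSVM.clientObjective (ε g) ρ w (μ g) '' FDRSVM.clientFeasible nrm κ (S g))
        (J : ℝ) ∧
      IsLeast (Set.range (FDRSVM.localLagrangian nrm κ (ε g) ρ (S g) w (μ g))) (J : ℝ≥0∞)) ∧
    -- the optimal local model of the client program exists and is unique
    (∃! wg : FDRSVM.Feature P, ∃ (l : ℝ) (s : Fin (N g) → ℝ),
      FDRSVM.IsClientOptimal nrm κ (ε g) ρ (S g) w (μ g) (wg, l, s)) ∧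
    -- the minimizers of the local Lagrangian are exactly the optimal local models of the program
    (∀ wg : FDRSVM.Feature P,
      IsMinOn (FDRSVM.localLagrangian nrm κ (ε g) ρ (S g) w (μ g)) Set.univ wg ↔
        ∃ (l : ℝ) (s : Fin (N g) → ℝ),
          FDRSVM.IsClientOptimal nrm κ (ε g) ρ (S g) w (μ g) (wg, l, s)) ∧
    -- they minimize the global Lagrangian in block `g`, and are the only minimizers if `0 < α g`
    (∀ (wloc : Fin G → FDRSVM.Feature P) (wg : FDRSVM.Feature P),
      ((∃ (l : ℝ) (s : Fin (N g) → ℝ),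
          FDRSVM.IsClientOptimal nrm κ (ε g) ρ (S g) w (μ g) (wg, l, s)) →
        IsMinOn (fun v => FDRSVM.augLagrangian nrm κ ε α ρ S (Function.update wloc g v) w μ)
          Set.univ wg) ∧
      (0 < α g →
        IsMinOn (fun v => FDRSVM.augLagrangian nrm κ ε α ρ S (Function.update wloc g v) w μ)
          Set.univ wg →
        ∃ (l : ℝ) (s : Fin (N g) → ℝ),
          FDRSVM.IsClientOptimal nrm κ (ε g) ρ (S g) w (μ g) (wg, l, s))) := by
  have hopt := FDRSVM.exists_isClientOptimal_iff nrm hnrm hκ (hε g) ρ (hN g) (S g) w (μ g)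
  have hloc := FDRSVM.isMinOn_localLagrangian_iff nrm hnrm hκ (hε g) hρ (hN g) (S g) w (μ g)
  obtain ⟨v₀, hv₀⟩ := FDRSVM.exists_forall_realLagrangian_le nrm hnrm hκ (hε g) hρ (hN g)
    (S g) w (μ g)
  refine ⟨⟨FDRSVM.convexOn_clientObjective _ hρ _ _, fun n => FDRSVM.convexOn_hinge_sub _ n,
    fun n => FDRSVM.convexOn_hinge_sub_mul_sub κ _ n, FDRSVM.convexOn_dualNorm_sub nrm hnrm,
    FDRSVM.convex_clientFeasible nrm hnrm κ _⟩, ?_, ?_, fun v => (hloc v).trans (hopt v).symm,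
    fun wloc v => ⟨?_, ?_⟩⟩
  · have h0 := FDRSVM.realLagrangian_nonneg nrm κ (ε g) hρ (S g) w (μ g) v₀
    refine ⟨NNReal.mk _ h0, ⟨?_, ?_⟩, ⟨v₀, ?_⟩, ?_⟩
    · obtain ⟨l, s, hz, h⟩ := FDRSVM.exists_clientObjective_eq nrm hnrm hκ (hε g) ρ (hN g)
        (S g) w (μ g) v₀
      exact ⟨_, hz, h⟩
    · rintro _ ⟨z, hz, rfl⟩
      exact (hv₀ z.1).trans
        (FDRSVM.realLagrangian_le_clientObjective nrm hnrm (hε g) ρ (hN g) (S g) w (μ g) hz)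
    · rw [FDRSVM.localLagrangian_eq nrm hnrm hκ (hε g) hρ (hN g),
        ENNReal.ofReal_eq_coe_nnreal h0]
    · rintro _ ⟨v, rfl⟩
      rw [FDRSVM.localLagrangian_eq nrm hnrm hκ (hε g) hρ (hN g),
        ← ENNReal.ofReal_eq_coe_nnreal h0]
      exact ENNReal.ofReal_le_ofReal (hv₀ v)
  · refine ⟨v₀, (hopt v₀).2 hv₀, fun v hv => ?_⟩
    exact (FDRSVM.strictConvexOn_realLagrangian nrm hnrm hκ (hε g) hρ (hN g) (S g) w
      (μ g)).eq_of_isMinOn (fun v' _ => (hopt v).1 hv v') (fun v' _ => hv₀ v')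
      (Set.mem_univ _) (Set.mem_univ _)
  · intro hv v' _
    have h := (hloc v).2 ((hopt v).1 hv) (Set.mem_univ v')
    simp only [Set.mem_ofPred_eq, FDRSVM.augLagrangian_update] at h ⊢
    gcongr
  · intro hαg hv
    refine (hopt v).2 ((hloc v).1 fun v' hv' => ?_)
    have h := hv hv'
    simp only [Set.mem_ofPred_eq, FDRSVM.augLagrangian_update] at h ⊢
    -- the other blocks contribute a finite constant, which can be cancelled
    have hfin : ∑ h ∈ Finset.univ.erase g, ENNReal.ofReal (α h) *
        FDRSVM.localLagrangian nrm κ (ε h) ρ (S h) w (μ h) (wloc h) ≠ ⊤ := by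
      refine ENNReal.sum_ne_top.2 fun h _ => ENNReal.mul_ne_top ENNReal.ofReal_ne_top ?_
      rw [FDRSVM.localLagrangian_eq nrm hnrm hκ (hε h) hρ (hN h)]
      exact ENNReal.ofReal_ne_top
    exact (ENNReal.mul_le_mul_iff_right (ENNReal.ofReal_pos.2 hαg).ne' ENNReal.ofReal_ne_top).1
      ((ENNReal.add_le_add_iff_right hfin).1 h)
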